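/- Let $d\in\mathbb N$ and let $D[0,1]$ be the space of functions $f:[0,1]\to\mathbb R^d$ that are right continuous with left limits and left continuous at $1$, with the $\sigma$-algebra generated by the evaluations; put $f(0-):=f(0)$. Let $[[x,y]]$ denote the segment between $x,y\in\mathbb R^d$, and define the graphs $\Gamma_f=\{(z,t): z=f(t-)\text{ or }z=f(t)\}$ and $\overline{\Gamma_f}=\{(z,t): z\in[[f(t-),f(t)]]\}$, subsets of $\mathbb R^d\times[0,1]$. Let $\mathcal T\in\{J_1,J_2,M_1,M_2\}$, and let $d_{\mathcal T}$ be the corresponding Skorokhod metric on $D[0,1]$: * $d_{J_1}(f,g)=\inf_\lambda \|f\circ\lambda-g\|_\infty\vee\|\lambda-\mathrm{id}\|_\infty$ over continuous bijections $\lambda$ of $[0,1]$; * $d_{M_1}(f,g)=\inf \|u_1-u_2\|_\infty\vee\|r_1-r_2\|_\infty$ over all parametric representations $(u_1,r_1)$ of $\overline{\Gamma_f}$ and $(u_2,r_2)$ of $\overline{\Gamma_g}$. A parametric representation of $\overline{\Gamma_f}$ is a continuous map of $[0,1]$ onto $\overline{\Gamma_f}$ that is non-decreasing for the order $(z_1,t_1)\le(z_2,t_2)$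 iff $t_1<t_2$, or $t_1=t_2$ and $|f(t_1-)-z_1|\le|f(t_2-)-z_2|$; * $d_{J_2}(f,g)$ and $d_{M_2}(f,g)$ are the Hausdorff distances, with respect to $|x-y|\vee|t-s|$, of $\Gamma_f,\Gamma_g$ and of $\overline{\Gamma_f},\overline{\Gamma_g}$, respectively. On a probability space $(\Omega,\mathcal A,\mathbb P)$ let, for each $n$, $Y^{(n)}=(Y^{(n)}_k)_{k\ge0}$ be a time homogeneous Markov chain in $\mathbb R^d$ with a transition kernel $\kappa_n$ on $\mathbb R^d$; $\mathbb P(Y^{(n)}_k\in\cdot\mid Y^{(n)}_0=x)$ denotes the $k$-step transition probability $\kappa_n^k(x,\cdot)$. Let $X^{n,\mathcal T}$ and $X$ be $D[0,1]$-valued random variables on $\Omega$ such that, for every $\omega$, $X^{n,\mathcal T}$ is a $\mathcal T$-embedding of $Y^{(n)}$: for all $0\le k<n$, $X^{n,\mathcal T}_{k/n}=Y^{(n)}_k$, and for all $t\in(\frac kn,\frac{k+1}n)$ * $X^{n,J_1}_t=Y^{(n)}_k$ (step functions), * $X^{n,M_1}_t=Y^{(n)}_k+(nt-k)(Y^{(n)}_{k+1}-Y^{(n)}_k)$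 (linear interpolation), * $X^{n,J_2}_t\in\{Y^{(n)}_k,Y^{(n)}_{k+1}\}$ (multiple steps), * $X^{n,M_2}_t\in[[Y^{(n)}_k,Y^{(n)}_{k+1}]]$ (any such function). Let $X^{n,J_1}$ denote the step function embedding of $Y^{(n)}$. For $D[0,1]$-valued random variables $Z^n,Z$ write $Z^n\xrightarrow{d}Z$ w.r.t. $\mathcal T$ if $\mathbb E\,G(Z^n)\to\mathbb E\,G(Z)$ for all bounded $d_{\mathcal T}$-continuous $G:D[0,1]\to\mathbb R$, and $Z^n\xrightarrow{\mathrm{fdd}}Z$ on $I\subset[0,1]$ if $(Z^n_{t_1},\dots,Z^n_{t_k})\xrightarrow{d}(Z_{t_1},\dots,Z_{t_k})$ for all $k$ and all $t_1,\dots,t_k\in I$. **Lemma.** Suppose that $$\forall\varepsilon>0\ \forall R>0:\quad \lim_{h\downarrow0}\,\limsup_{n\to\infty}\,\sup_{|x|<R,\;0\le t\le h}\mathbb P\big(|Y^{(n)}_{\lfloor tn\rfloor}-x|>\varepsilon\,\big|\,Y^{(n)}_0=x\big)=0$$ and that $X^{n,\mathcal T}\xrightarrow{d}X$ w.r.t.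 $\mathcal T$. Then $X^{n,\mathcal T}\xrightarrow{\mathrm{fdd}}X$ on some dense subset of $[0,1]$; and for every dense subset $I$ of $[0,1]$ with $X^{n,\mathcal T}\xrightarrow{\mathrm{fdd}}X$ on $I$, also $$X^{n,J_1}\xrightarrow{\mathrm{fdd}}X\quad\text{on } I.$$ -/

import Mathlib

open MeasureTheory ProbabilityTheory Filter Topology
open scoped unitInterval ENNReal BoundedContinuousFunction

noncomputable section

namespace SkorokhodEmbedding

/-- The state space `ℝ^d` with the Euclidean norm. -/
abbrev E (d : ℕ) : Type := EuclideanSpace ℝ (Fin d)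

/-- The Skorokhod space `D[0,1]`: right continuous functions `[0,1] → ℝ^d` with left limits
which are left continuous at `1`. -/
structure D (d : ℕ) where
  toFun : I → E d
  right_continuous : ∀ s, Tendsto toFun (𝓝[>] s) (𝓝 (toFun s))
  left_limits : ∀ s, ∃ l, Tendsto toFun (𝓝[<] s) (𝓝 l)
  left_continuous_one : Tendsto toFun (𝓝[<] (1 : I)) (𝓝 (toFun 1))

instance (d : ℕ) : CoeFun (D d) (fun _ => I → E d) := ⟨D.toFun⟩

/-- The σ-algebra on `D[0,1]` generated by the evaluations `f ↦ f(t)`. -/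
instance (d : ℕ) : MeasurableSpace (D d) :=
  ⨆ t : I, MeasurableSpace.comap (fun f : D d => f t) inferInstance

/-- The left limit `f(t-)`, with `f(0-) = f(0)`. -/
def D.left {d : ℕ} (f : D d) (t : I) : E d := Function.leftLim f.toFun t

/-- The incomplete graph of `f`. -/
def graph {d : ℕ} (f : D d) : Set (E d × I) := {p | p.1 = f.left p.2 ∨ p.1 = f p.2}

/-- The complete graph of `f`. -/
def completeGraph {d : ℕ} (f : D d) : Set (E d × I) :=
  {p | p.1 ∈ segment ℝ (f.left p.2) (f p.2)}

/-- The order on the complete graph of `f`. -/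
def graphLE {d : ℕ} (f : D d) (p q : E d × I) : Prop :=
  p.2 < q.2 ∨ (p.2 = q.2 ∧ ‖f.left p.2 - p.1‖ ≤ ‖f.left q.2 - q.1‖)

/-- `(u, r)` is a parametric representation of the complete graph of `f`. -/
def IsParamRep {d : ℕ} (f : D d) (u : I → E d) (r : I → I) : Prop :=
  Continuous u ∧ Continuous r ∧ Set.range (fun s => (u s, r s)) = completeGraph f ∧
    ∀ s₁ s₂ : I, s₁ ≤ s₂ → graphLE f (u s₁, r s₁) (u s₂, r s₂)

/-- The names of the four Skorokhod topologies. -/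
inductive SkorokhodTopology where
  | J1
  | J2
  | M1
  | M2

/-- The metric `d_{J₁}`. -/
def distJ1 {d : ℕ} (f g : D d) : ℝ≥0∞ :=
  ⨅ (l : I → I) (_ : Function.Bijective l ∧ Continuous l),
    (⨆ t, edist (f (l t)) (g t)) ⊔ (⨆ t, edist (l t) t)

/-- The metric `d_{M₁}`. -/
def distM1 {d : ℕ} (f g : D d) : ℝ≥0∞ :=
  ⨅ (u₁ : I → E d) (r₁ : I → I) (u₂ : I → E d) (r₂ : I → I)
    (_ : IsParamRep f u₁ r₁ ∧ IsParamRep g u₂ r₂),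
    (⨆ s, edist (u₁ s) (u₂ s)) ⊔ (⨆ s, edist (r₁ s) (r₂ s))

/-- The metric `d_T` on `D[0,1]`, for `J₂` and `M₂` the Hausdorff distance of the graphs with
respect to `|x - y| ∨ |t - s|`. -/
def skorokhodDist {d : ℕ} (T : SkorokhodTopology) (f g : D d) : ℝ≥0∞ :=
  match T with
  | .J1 => distJ1 f g
  | .J2 => Metric.hausdorffEDist (graph f) (graph g)
  | .M1 => distM1 f g
  | .M2 => Metric.hausdorffEDist (completeGraph f) (completeGraph g)

/-- `G : D[0,1] → ℝ` is continuous with respect to the metric `d_T`. -/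
def IsContinuous {d : ℕ} (T : SkorokhodTopology) (G : D d → ℝ) : Prop :=
  ∀ f : D d, ∀ ε : ℝ, 0 < ε → ∃ δ : ℝ≥0∞, 0 < δ ∧
    ∀ g : D d, skorokhodDist T g f < δ → |G g - G f| < ε

/-- Convergence in distribution with respect to `T` of `D[0,1]`-valued random variables:
`𝔼 G(Xⁿ) → 𝔼 G(X)` for all bounded `T`-continuous `G`. -/
def TendstoInDist {Ω : Type*} [MeasurableSpace Ω] {d : ℕ} (T : SkorokhodTopology) (P : Measure Ω)
    (Xn : ℕ → Ω → D d) (X : Ω → D d) : Prop :=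
  ∀ G : D d → ℝ, (∃ C : ℝ, ∀ f, |G f| ≤ C) → IsContinuous T G →
    Tendsto (fun n => ∫ ω, G (Xn n ω) ∂P) atTop (𝓝 (∫ ω, G (X ω) ∂P))

/-- Convergence of the finite dimensional distributions on the time set `S`. -/
def TendstoFDD {Ω : Type*} [MeasurableSpace Ω] {d : ℕ} (P : Measure Ω) [IsProbabilityMeasure P]
    (Xn : ℕ → Ω → D d) (X : Ω → D d) (S : Set I) : Prop :=
  ∀ (k : ℕ) (t : Fin k → I), (∀ i, t i ∈ S) →
    TendstoInDistribution (fun n ω (i : Fin k) => Xn n ω (t i)) atTop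
      (fun ω (i : Fin k) => X ω (t i)) (fun _ => P) P

/-- The prescribed behaviour of the `T`-embedding at a time `t` strictly between `k/n` and
`(k+1)/n`, where `a`, `b` are the values of the sequence at `k` and `k+1`:
step function, linear interpolation, multiple steps, arbitrary values in the segment. -/
def EmbeddingRule {d : ℕ} (T : SkorokhodTopology) (n k : ℕ) (a b : E d) (t : I) (x : E d) : Prop :=
  match T with
  | .J1 => x = a
  | .M1 => x = a + ((n : ℝ) * t - k) • (b - a)
  | .J2 => x = a ∨ x = b
  | .M2 => x ∈ segment ℝ a b

/-- `x ∈ D[0,1]` is a `T`-embedding `x^{n,T}` of the sequence `y`. -/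
def IsEmbedding {d : ℕ} (T : SkorokhodTopology) (n : ℕ) (y : ℕ → E d) (x : D d) : Prop :=
  ∀ k < n, (∀ t : I, (t : ℝ) = k / n → x t = y k) ∧
    ∀ t : I, (k : ℝ) / n < t → (t : ℝ) < (k + 1) / n →
      EmbeddingRule T n k (y k) (y (k + 1)) t (x t)

/-- The step function embedding `x^{n,J₁}` of the sequence `y`, with value `y_k` on
`[k/n, (k+1)/n)` for `k < n` and the value `y_{n-1}` at `1`. -/
def stepEmbedding {d : ℕ} (n : ℕ) (y : ℕ → E d) : D d where
  toFun t := y (min ⌊(n : ℝ) * t⌋₊ (n - 1))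
  right_continuous s := by
    apply tendsto_nhds_of_eventually_eq
    have hs : 0 ≤ (n : ℝ) * s := mul_nonneg n.cast_nonneg s.2.1
    have hc : Tendsto (fun t : I => (n : ℝ) * t) (𝓝[>] s) (𝓝 ((n : ℝ) * s)) :=
      Continuous.tendsto' (by fun_prop) s _ rfl |>.mono_left nhdsWithin_le_nhds
    filter_upwards [hc.eventually_lt_const (Nat.lt_floor_add_one _), self_mem_nhdsWithin]
      with t h1 h2
    have h3 : (n : ℝ) * s ≤ (n : ℝ) * t :=
      mul_le_mul_of_nonneg_left (le_of_lt h2) n.cast_nonneg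
    have : ⌊(n : ℝ) * t⌋₊ = ⌊(n : ℝ) * s⌋₊ :=
      (Nat.floor_eq_iff (hs.trans h3)).2 ⟨(Nat.floor_le hs).trans h3, h1⟩
    simp [this]
  left_limits s := by
    refine ⟨y (⌈(n : ℝ) * s⌉₊ - 1), tendsto_nhds_of_eventually_eq ?_⟩
    rcases Nat.eq_zero_or_pos n with rfl | hn
    · simp
    have hn' : (0 : ℝ) < n := by exact_mod_cast hn
    have hc : Tendsto (fun t : I => (n : ℝ) * t) (𝓝[<] s) (𝓝 ((n : ℝ) * s)) :=
      Continuous.tendsto' (by fun_prop) s _ rfl |>.mono_left nhdsWithin_le_nhds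
    rcases eq_or_ne s 0 with rfl | h0
    · filter_upwards [self_mem_nhdsWithin] with t ht
      exact absurd (show t < 0 from ht) (not_lt.2 t.2.1)
    have hs0 : 0 < (n : ℝ) * s :=
      mul_pos hn' (lt_of_le_of_ne s.2.1 (fun h => h0 (Subtype.ext h.symm)))
    obtain ⟨m, hm⟩ : ∃ m, ⌈(n : ℝ) * s⌉₊ = m + 1 :=
      Nat.exists_eq_succ_of_ne_zero (Nat.ceil_pos.2 hs0).ne'
    have hm1 : (m : ℝ) < (n : ℝ) * s := Nat.lt_ceil.1 (by omega)
    have hm2 : (n : ℝ) * s ≤ (m : ℝ) + 1 := by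
      have := Nat.le_ceil ((n : ℝ) * s)
      rw [hm] at this
      exact_mod_cast this
    have hmn : m < n := by
      have : (n : ℝ) * s ≤ n := mul_le_of_le_one_right hn'.le s.2.2
      exact_mod_cast hm1.trans_le this
    filter_upwards [hc.eventually_const_lt hm1, self_mem_nhdsWithin] with t h1 h2
    have h3 : (n : ℝ) * t < (n : ℝ) * s := mul_lt_mul_of_pos_left h2 hn'
    have : ⌊(n : ℝ) * t⌋₊ = m :=
      (Nat.floor_eq_iff (mul_nonneg hn'.le t.2.1)).2 ⟨h1.le, h3.trans_le hm2⟩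
    rw [this, hm, min_eq_left (by omega), Nat.add_sub_cancel]
  left_continuous_one := by
    apply tendsto_nhds_of_eventually_eq
    rcases Nat.eq_zero_or_pos n with rfl | hn
    · simp
    have hn' : (0 : ℝ) < n := by exact_mod_cast hn
    have hc : Tendsto (fun t : I => (n : ℝ) * t) (𝓝[<] 1) (𝓝 ((n : ℝ))) :=
      Continuous.tendsto' (by fun_prop) 1 _ (by simp) |>.mono_left nhdsWithin_le_nhds
    filter_upwards [hc.eventually_const_lt (sub_one_lt (n : ℝ))] with t h1
    have h2 : n - 1 ≤ ⌊(n : ℝ) * t⌋₊ := by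
      apply Nat.le_floor
      rw [Nat.cast_sub hn, Nat.cast_one]
      exact h1.le
    simp [min_eq_right h2]

/-- The step function embedding is an embedding for `J₁`. -/
theorem isEmbedding_stepEmbedding {d : ℕ} (n : ℕ) (y : ℕ → E d) :
    IsEmbedding .J1 n y (stepEmbedding n y) := by
  intro k hk
  have hn' : (0 : ℝ) < n := by exact_mod_cast (Nat.zero_le k).trans_lt hk
  have key : ∀ t : I, (k : ℝ) / n ≤ t → (t : ℝ) < (k + 1) / n → stepEmbedding n y t = y k := by
    intro t h1 h2
    rw [div_le_iff₀' hn'] at h1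
    rw [lt_div_iff₀' hn'] at h2
    have : ⌊(n : ℝ) * t⌋₊ = k := (Nat.floor_eq_iff (mul_nonneg hn'.le t.2.1)).2 ⟨h1, h2⟩
    simp only [stepEmbedding, this, min_eq_left (Nat.le_sub_one_of_lt hk)]
  refine ⟨fun t ht => key t ht.ge ?_, fun t h1 h2 => key t h1.le h2⟩
  rw [ht]
  gcongr
  linarith

/-- `Y` is a time homogeneous Markov chain with transition kernel `κ`, i.e.
`P(Y_{k+1} ∈ B | Y_0, …, Y_k) = κ(Y_k, B)` almost surely. -/
def IsMarkovChain {Ω S : Type*} [MeasurableSpace Ω] [MeasurableSpace S] (P : Measure Ω)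
    (κ : Kernel S S) (Y : ℕ → Ω → S) : Prop :=
  (∀ k, Measurable (Y k)) ∧ ∀ (k : ℕ) (B : Set S), MeasurableSet B →
    P[(Y (k + 1) ⁻¹' B).indicator (fun _ => (1 : ℝ)) |
        ⨆ j : Fin (k + 1), MeasurableSpace.comap (Y j) inferInstance]
      =ᵐ[P] fun ω => (κ (Y k ω)).real B

/-- The condition
`∀ ε, R > 0: lim_{h ↓ 0} limsup_n sup_{|x| < R, 0 ≤ t ≤ h} P(|Y^{(n)}_⌊tn⌋ - x| > ε | Y^{(n)}_0 = x) = 0`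
for chains with transition kernels `κ n`; the conditional law of `Y^{(n)}_k` given
`Y^{(n)}_0 = x` is the `k`-step transition probability `(κ n ^ k) x`. -/
def TightnessCondition {d : ℕ} (κ : ℕ → Kernel (E d) (E d)) : Prop :=
  ∀ ε : ℝ, 0 < ε → ∀ R : ℝ, 0 < R →
    Tendsto (fun h : ℝ => limsup (fun n : ℕ =>
        ⨆ (x : E d) (_ : ‖x‖ < R) (t : ℝ) (_ : 0 ≤ t ∧ t ≤ h),
          (κ n ^ ⌊t * n⌋₊) x {y | ε < ‖y - x‖}) atTop)
      (𝓝[>] 0) (𝓝 0)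

end SkorokhodEmbedding

end

noncomputable section

namespace SkorokhodEmbedding

variable {d : ℕ}

/-! All four metrics share one consequence (`exists_edist_completeGraph_lt`): if `g` is `δ`-close to
`f`, each point `(g s, s)` is `δ`-close to the completed graph of `f`, and conversely. Hence two
kinds of functionals are continuous for every topology: the truncated excess of the supremum norm
(`isContinuous_excess`) and the time averages of `φ(f(t₁ + h s), …, f(t_k + h s))`
(`isContinuous_average`).

The excess gives a ball containing the embedded chains with high probability, uniformly in time.
There the tightness condition and the Markov property make the increments of the chain over short
times small in probability, uniformly in the starting index (`exists_eventually_increment_le`). So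
replacing `XT` at fixed times by its average over a short window to the right costs little,
uniformly in large `n`. The averages converge by hypothesis, and right continuity of `X` lets the
window shrink. This yields convergence at all times in `[0,1]` (`tendstoFDD_univ`), so the whole
interval serves as the dense set.

The step embedding differs from `XT` by at most one increment of the chain, which tends to zero in
probability. A Slutsky argument transfers the limit on any given time set
(`TendstoFDD.stepEmbedding`). -/

/-! ### Path properties: left limits, boundedness, countably many jumps. -/

theorem D.continuousWithinAt_Ici (f : D d) (s : I) : ContinuousWithinAt f.toFun (Set.Ici s) s :=
  continuousWithinAt_Ioi_iff_Ici.1 (f.right_continuous s)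

theorem D.tendsto_left (f : D d) (s : I) : Tendsto f.toFun (𝓝[<] s) (𝓝 (f.left s)) :=
  tendsto_leftLim_of_tendsto (f.left_limits s)

theorem D.continuousAt_one (f : D d) : ContinuousAt f.toFun 1 :=
  continuousAt_iff_continuous_left'_right'.2 ⟨f.left_continuous_one, f.right_continuous 1⟩

/-- The left limit is a cluster point of nearby values. Using full neighbourhoods covers `t = 0` as
well, where it is the value itself. -/
theorem D.left_mem_of_eventually (f : D d) {t : I} {K : Set (E d)} (hK : IsClosed K)
    (h : ∀ᶠ s in 𝓝 t, f s ∈ K) : f.left t ∈ K :=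
  isClosed_iff_clusterPt.1 hK _ (ClusterPt.mono (mapClusterPt_leftLim f.toFun t)
    (le_principal_iff.2 (h.filter_mono nhdsWithin_le_nhds)))

theorem D.fst_mem_of_mem_completeGraph (f : D d) {p : E d × I} {K : Set (E d)} (hK : IsClosed K)
    (hc : Convex ℝ K) (h : ∀ᶠ s in 𝓝 p.2, f s ∈ K) (hp : p ∈ completeGraph f) : p.1 ∈ K :=
  hc.segment_subset (f.left_mem_of_eventually hK h) h.self_of_nhds hp

theorem D.mem_completeGraph (f : D d) (t : I) : (f t, t) ∈ completeGraph f :=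
  right_mem_segment ℝ _ _

theorem graph_subset_completeGraph (f : D d) : graph f ⊆ completeGraph f := by
  rintro p (h | h)
  · rw [completeGraph, Set.mem_ofPred_eq, h]
    exact left_mem_segment ℝ _ _
  · rw [completeGraph, Set.mem_ofPred_eq, h]
    exact right_mem_segment ℝ _ _

theorem D.exists_norm_le (f : D d) : ∃ C : ℝ, ∀ t, ‖f t‖ ≤ C := by
  have key : ∃ C : ℝ, ∀ t ∈ (Set.univ : Set I), ‖f t‖ ≤ C := by
    refine isCompact_univ.induction_on (p := fun S : Set I => ∃ C : ℝ, ∀ t ∈ S, ‖f t‖ ≤ C)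
      ⟨0, by simp⟩ (fun s t hst ⟨C, hC⟩ => ⟨C, fun u hu => hC u (hst hu)⟩) ?_ ?_
    · rintro s t ⟨C, hC⟩ ⟨C', hC'⟩
      exact ⟨max C C', fun u hu => hu.elim (fun h => le_max_of_le_left (hC u h))
        fun h => le_max_of_le_right (hC' u h)⟩
    · intro s _
      rw [nhdsWithin_univ]
      obtain ⟨a, ha⟩ := (f.continuousWithinAt_Ici s).norm.isBoundedUnder_le
      obtain ⟨b, hb⟩ := (f.tendsto_left s).norm.isBoundedUnder_le
      rw [eventually_map] at ha hb
      refine ⟨{t | ‖f t‖ ≤ max a b}, ?_, max a b, fun t ht => ht⟩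
      rw [← nhdsLT_sup_nhdsGE]
      exact ⟨hb.mono fun t ht => le_max_of_le_right ht, ha.mono fun t ht => le_max_of_le_left ht⟩
  exact key.imp fun C hC t => hC t trivial

/-- On either side of `s` the values approach a single limit. Nearby left limits are then close to
the same limit, so large jumps cannot accumulate at `s`. -/
theorem D.eventually_norm_left_sub_le (f : D d) (s : I) {ε : ℝ} (hε : 0 < ε) :
    ∀ᶠ t in 𝓝[≠] s, ‖f.left t - f t‖ ≤ ε := by
  have key : ∀ (U : Set I) (z : E d), IsOpen U → Tendsto f.toFun (𝓝[U] s) (𝓝 z) →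
      ∀ᶠ t in 𝓝[U] s, ‖f.left t - f t‖ ≤ ε := by
    intro U z hU hz
    have h1 := eventually_eventually_nhdsWithin.2
      (hz.eventually (Metric.closedBall_mem_nhds z (half_pos hε)))
    filter_upwards [h1, self_mem_nhdsWithin] with t ht htU
    rw [hU.nhdsWithin_eq htU] at ht
    have h2 := f.left_mem_of_eventually Metric.isClosed_closedBall ht
    have h3 := ht.self_of_nhds
    rw [← dist_eq_norm]
    calc _ ≤ dist (f.left t) z + dist (f t) z := dist_triangle_right _ _ _
      _ ≤ ε / 2 + ε / 2 := add_le_add h2 h3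
      _ = ε := add_halves ε
  rw [← nhdsLT_sup_nhdsGT, eventually_sup]
  exact ⟨key _ _ isOpen_Iio (f.tendsto_left s), key _ _ isOpen_Ioi (f.right_continuous s)⟩

/-- By compactness, infinitely many jumps larger than `1 / (m + 1)` would accumulate somewhere. -/
theorem D.countable_not_continuousAt (f : D d) : {t | ¬ ContinuousAt f.toFun t}.Countable := by
  have hfin : ∀ m : ℕ, {t | 1 / ((m : ℝ) + 1) < ‖f.left t - f t‖}.Finite := by
    intro m
    by_contra hinf
    obtain ⟨s, hs⟩ := Set.Infinite.exists_accPt_principal hinf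
    rw [accPt_iff_frequently_nhdsNE] at hs
    obtain ⟨t, h1, h2⟩ := (hs.and_eventually
      (f.eventually_norm_left_sub_le s (Nat.one_div_pos_of_nat (n := m)))).exists
    exact (not_lt.2 h2) h1
  refine (Set.countable_iUnion fun m => (hfin m).countable).mono fun t ht => ?_
  have hne : 0 < ‖f.left t - f t‖ := by
    rw [norm_pos_iff, sub_ne_zero]
    intro h
    exact ht (continuousAt_iff_continuous_left'_right'.2
      ⟨by simpa [ContinuousWithinAt, h] using f.tendsto_left t, f.right_continuous t⟩)
  obtain ⟨m, hm⟩ := exists_nat_one_div_lt hne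
  exact Set.mem_iUnion.2 ⟨m, hm⟩

/-! ### Graph proximity common to the four metrics. -/

theorem exists_edist_completeGraph_lt (T : SkorokhodTopology) {f g : D d} {δ : ℝ≥0∞}
    (h : skorokhodDist T g f < δ) :
    (∀ s, ∃ p ∈ completeGraph f, edist (g s, s) p < δ) ∧
      ∀ s, ∃ p ∈ completeGraph g, edist (f s, s) p < δ := by
  cases T with
  | J1 =>
    simp only [skorokhodDist, distJ1, iInf_lt_iff, exists_prop] at h
    obtain ⟨l, ⟨hl, -⟩, h⟩ := h
    have key : ∀ t, edist (g (l t), l t) (f t, t) < δ := fun t =>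
      lt_of_le_of_lt (sup_le_sup (le_iSup (fun t => edist (g (l t)) (f t)) t)
        (le_iSup (fun t => edist (l t) t) t)) h
    refine ⟨fun s => ?_, fun s => ⟨_, g.mem_completeGraph (l s), ?_⟩⟩
    · obtain ⟨t, rfl⟩ := hl.2 s
      exact ⟨_, f.mem_completeGraph t, key t⟩
    · rw [edist_comm]
      exact key s
  | J2 =>
    simp only [skorokhodDist] at h
    refine ⟨fun s => ?_, fun s => ?_⟩
    · obtain ⟨p, hp, hlt⟩ := Metric.exists_edist_lt_of_hausdorffEDist_lt
        (show (g s, s) ∈ graph g from Or.inr rfl) h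
      exact ⟨p, graph_subset_completeGraph f hp, hlt⟩
    · rw [Metric.hausdorffEDist_comm] at h
      obtain ⟨p, hp, hlt⟩ := Metric.exists_edist_lt_of_hausdorffEDist_lt
        (show (f s, s) ∈ graph f from Or.inr rfl) h
      exact ⟨p, graph_subset_completeGraph g hp, hlt⟩
  | M1 =>
    simp only [skorokhodDist, distM1, iInf_lt_iff, exists_prop] at h
    obtain ⟨u₁, r₁, u₂, r₂, ⟨⟨-, -, h₁, -⟩, ⟨-, -, h₂, -⟩⟩, h⟩ := h
    have key : ∀ t, edist (u₁ t, r₁ t) (u₂ t, r₂ t) < δ := fun t =>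
      lt_of_le_of_lt (sup_le_sup (le_iSup (fun t => edist (u₁ t) (u₂ t)) t)
        (le_iSup (fun t => edist (r₁ t) (r₂ t)) t)) h
    refine ⟨fun s => ?_, fun s => ?_⟩
    · obtain ⟨t, ht⟩ := h₁.symm ▸ g.mem_completeGraph s
      exact ⟨_, h₂ ▸ Set.mem_range_self t, ht ▸ key t⟩
    · obtain ⟨t, ht⟩ := h₂.symm ▸ f.mem_completeGraph s
      refine ⟨_, h₁ ▸ Set.mem_range_self t, ?_⟩
      rw [edist_comm]
      exact ht ▸ key t
  | M2 =>
    simp only [skorokhodDist] at h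
    refine ⟨fun s => Metric.exists_edist_lt_of_hausdorffEDist_lt (g.mem_completeGraph s) h,
      fun s => ?_⟩
    rw [Metric.hausdorffEDist_comm] at h
    exact Metric.exists_edist_lt_of_hausdorffEDist_lt (f.mem_completeGraph s) h

/-- The filter of `d_T`-neighbourhoods of `f`. -/
def nhdsT (T : SkorokhodTopology) (f : D d) : Filter (D d) :=
  comap (fun g => skorokhodDist T g f) (𝓝 0)

/-- Needed for dominated convergence along this filter. -/
instance (T : SkorokhodTopology) (f : D d) : (nhdsT T f).IsCountablyGenerated := by
  unfold nhdsT; infer_instance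

theorem nhdsT_hasBasis (T : SkorokhodTopology) (f : D d) :
    (nhdsT T f).HasBasis (fun δ : ℝ≥0∞ => 0 < δ) fun δ => {g | skorokhodDist T g f < δ} :=
  ENNReal.nhds_zero_basis.comap _

theorem isContinuous_of_tendsto {T : SkorokhodTopology} {G : D d → ℝ}
    (h : ∀ f, Tendsto G (nhdsT T f) (𝓝 (G f))) : IsContinuous T G := by
  intro f ε hε
  obtain ⟨δ, hδ, H⟩ := ((nhdsT_hasBasis T f).tendsto_iff Metric.nhds_basis_ball).1 (h f) ε hε
  exact ⟨δ, hδ, fun g hg => H g hg⟩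

/-- Evaluation at a continuity point of `f` is continuous at `f` for all four topologies. -/
theorem tendsto_eval_nhdsT (T : SkorokhodTopology) {f : D d} {t : I}
    (ht : ContinuousAt f.toFun t) : Tendsto (fun g : D d => g t) (nhdsT T f) (𝓝 (f t)) := by
  rw [Metric.nhds_basis_closedBall.tendsto_right_iff]
  intro ε hε
  -- The nested form puts left limits and jump segments at times near `t` into the same convex ball.
  have h1 : ∀ᶠ s in 𝓝 t, ∀ᶠ u in 𝓝 s, f u ∈ Metric.closedBall (f t) (ε / 2) :=
    (ht.eventually (Metric.closedBall_mem_nhds _ (half_pos hε))).eventually_nhds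
  obtain ⟨η, hη, hball⟩ := EMetric.mem_nhds_iff.1 h1
  have hpos : 0 < min η (ENNReal.ofReal (ε / 2)) := lt_min hη (by simpa using hε)
  filter_upwards [(nhdsT_hasBasis T f).mem_of_mem hpos] with g hg
  obtain ⟨p, hp, hlt⟩ := (exists_edist_completeGraph_lt T hg).1 t
  have h2 : edist (g t) p.1 < ENNReal.ofReal (ε / 2) :=
    (le_max_left _ _).trans_lt (hlt.trans_le (min_le_right _ _))
  have h3 : edist t p.2 < η := (le_max_right _ _).trans_lt (hlt.trans_le (min_le_left _ _))
  have h4 := f.fst_mem_of_mem_completeGraph Metric.isClosed_closedBall (convex_closedBall _ _)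
    (hball (by rwa [Metric.mem_eball, edist_comm])) hp
  rw [edist_lt_ofReal] at h2
  rw [Metric.mem_closedBall] at h4 ⊢
  linarith [dist_triangle (g t) p.1 (f t)]

/-! ### A continuous functional controlling the supremum norm. -/

/-- The amount by which the supremum of `‖f‖` exceeds `R`, truncated at `1`. -/
def excess (R : ℝ) (f : D d) : ℝ := ⨆ t, min 1 (max 0 (‖f t‖ - R))

theorem bddAbove_excess (R : ℝ) (f : D d) :
    BddAbove (Set.range fun t => min 1 (max 0 (‖f t‖ - R))) :=
  ⟨1, by rintro _ ⟨t, rfl⟩; exact min_le_left _ _⟩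

theorem le_excess (R : ℝ) (f : D d) (t : I) : min 1 (max 0 (‖f t‖ - R)) ≤ excess R f :=
  le_ciSup (bddAbove_excess R f) t

theorem excess_nonneg (R : ℝ) (f : D d) : 0 ≤ excess R f :=
  (le_min zero_le_one (le_max_left _ _)).trans (le_excess R f 0)

theorem excess_le_one (R : ℝ) (f : D d) : excess R f ≤ 1 := ciSup_le fun _ => min_le_left _ _

/-- Below the truncation level, all values lie in the ball of radius `R + excess R f`. It is closed
and convex, hence contains the jump segments. -/
theorem le_excess_of_mem_completeGraph (R : ℝ) {f : D d} {p : E d × I}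
    (hp : p ∈ completeGraph f) : min 1 (max 0 (‖p.1‖ - R)) ≤ excess R f := by
  rcases lt_or_ge (excess R f) 1 with h1 | h1
  · have hK : ∀ s, f s ∈ Metric.closedBall (0 : E d) (R + excess R f) := by
      intro s
      have h2 := le_excess R f s
      rw [min_le_iff] at h2
      have h3 := (le_max_right _ _).trans (h2.resolve_left (not_le.2 h1))
      rw [mem_closedBall_zero_iff]
      linarith
    have h4 := f.fst_mem_of_mem_completeGraph Metric.isClosed_closedBall (convex_closedBall _ _)
      (Eventually.of_forall hK) hp
    rw [mem_closedBall_zero_iff] at h4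
    exact (min_le_right _ _).trans (max_le (excess_nonneg R f) (by linarith))
  · exact (min_le_left _ _).trans h1

theorem excess_le_add (R : ℝ) {f g : D d} {ε : ℝ} (hε : 0 < ε)
    (h : ∀ s, ∃ p ∈ completeGraph f, edist (g s, s) p < ENNReal.ofReal ε) :
    excess R g ≤ excess R f + ε := by
  refine ciSup_le fun s => ?_
  obtain ⟨p, hp, hlt⟩ := h s
  have h1 : dist (g s) p.1 < ε := edist_lt_ofReal.1 ((le_max_left _ _).trans_lt hlt)
  have h2 : ‖g s‖ ≤ ‖p.1‖ + ε := by
    rw [dist_eq_norm] at h1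
    linarith [norm_le_norm_add_norm_sub' (g s) p.1]
  calc min 1 (max 0 (‖g s‖ - R)) ≤ min 1 (max 0 (‖p.1‖ - R)) + ε := by
        rw [← min_add_add_right, ← max_add_add_right]
        exact min_le_min (by linarith) (max_le_max (by linarith) (by linarith))
    _ ≤ excess R f + ε := by
        gcongr
        exact le_excess_of_mem_completeGraph R hp

theorem isContinuous_excess (T : SkorokhodTopology) (R : ℝ) :
    IsContinuous T (excess R : D d → ℝ) := by
  intro f ε hε
  refine ⟨ENNReal.ofReal (ε / 2), by simpa using hε, fun g hg => ?_⟩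
  obtain ⟨h1, h2⟩ := exists_edist_completeGraph_lt T hg
  have h3 := excess_le_add R (half_pos hε) h1
  have h4 := excess_le_add R (half_pos hε) h2
  rw [abs_lt]
  constructor <;> linarith

theorem excess_eq_zero {R : ℝ} {f : D d} (h : ∀ t, ‖f t‖ ≤ R) : excess R f = 0 :=
  le_antisymm (ciSup_le fun t => (min_le_right _ _).trans (max_le le_rfl (by linarith [h t])))
    (excess_nonneg R f)

/-! ### Continuity of time averages. -/

/-- The time `t + h s`, stopped at `1`. -/
def shift (h : ℝ) (t s : I) : I := Set.projIcc 0 1 zero_le_one ((t : ℝ) + h * s)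

theorem continuous_shift (h : ℝ) (t : I) : Continuous (shift h t) :=
  continuous_projIcc.comp (by fun_prop)

theorem coe_shift {h : ℝ} (hh : 0 ≤ h) (t s : I) : (shift h t s : ℝ) = min 1 (t + h * s) := by
  have : 0 ≤ (t : ℝ) + h * s := add_nonneg t.2.1 (mul_nonneg hh s.2.1)
  simp [shift, Set.coe_projIcc, this]

theorem le_shift {h : ℝ} (hh : 0 ≤ h) (t s : I) : t ≤ shift h t s := by
  rw [← Subtype.coe_le_coe, coe_shift hh]
  exact le_min t.2.2 (le_add_of_nonneg_right (mul_nonneg hh s.2.1))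

/-- The shift is injective in `s` until it stops at `1`, and `1` is a continuity point. So only
countably many `s` hit a jump. -/
theorem ae_continuousAt_shift (f : D d) {h : ℝ} (hh : 0 < h) (t : I) :
    ∀ᵐ s : I, ContinuousAt f.toFun (shift h t s) := by
  rw [ae_iff]
  refine Set.Countable.measure_zero ?_ _
  refine Set.MapsTo.countable_of_injOn (f := shift h t) (fun s hs => hs) ?_
    f.countable_not_continuousAt
  have key : ∀ s, ¬ ContinuousAt f.toFun (shift h t s) → (shift h t s : ℝ) = t + h * s := by
    intro s hs
    rw [coe_shift hh.le]
    refine min_eq_right (le_of_not_ge fun h1 => hs ?_)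
    have : shift h t s = 1 := Subtype.ext (by rw [coe_shift hh.le, min_eq_left h1]; rfl)
    exact this ▸ f.continuousAt_one
  intro s hs u hu hsu
  have h1 := key s hs
  rw [hsu, key u hu] at h1
  exact Subtype.ext (mul_left_cancel₀ hh.ne' (by linarith))

/-- The average of `φ(f(t₁ + h s), …, f(t_k + h s))` over `s`. -/
def average {k : ℕ} (φ : (Fin k → E d) → ℝ) (t : Fin k → I) (h : ℝ) (f : D d) : ℝ :=
  ∫ s : I, φ fun i => f (shift h (t i) s)

theorem abs_average_le {k : ℕ} {φ : (Fin k → E d) → ℝ} {C : ℝ} (hC : ∀ x, |φ x| ≤ C)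
    (t : Fin k → I) (h : ℝ) (f : D d) : |average φ t h f| ≤ C := by
  simpa [average] using norm_integral_le_of_norm_le_const (μ := (volume : Measure I))
    (f := fun s => φ fun i => f (shift h (t i) s)) (ae_of_all _ fun s => hC _)

theorem D.measurable (f : D d) : Measurable f.toFun :=
  measurable_of_countable_not_continuousAt f.countable_not_continuousAt

theorem isContinuous_average (T : SkorokhodTopology) {k : ℕ} {φ : (Fin k → E d) → ℝ}
    (hφ : Continuous φ) {C : ℝ} (hC : ∀ x, |φ x| ≤ C) (t : Fin k → I) {h : ℝ} (hh : 0 < h) :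
    IsContinuous T (average φ t h) := by
  refine isContinuous_of_tendsto fun f => ?_
  refine tendsto_integral_filter_of_dominated_convergence (fun _ => C)
    (Eventually.of_forall fun g => ?_) (Eventually.of_forall fun g => ae_of_all _ fun s => hC _)
    (integrable_const _) ?_
  · refine (hφ.measurable.comp (measurable_pi_lambda _ fun i => ?_)).aestronglyMeasurable
    exact g.measurable.comp (continuous_shift h (t i)).measurable
  · filter_upwards [ae_all_iff.2 fun i => ae_continuousAt_shift f hh (t i)] with s hs
    exact (hφ.tendsto _).comp (tendsto_pi_nhds.2 fun i => tendsto_eval_nhdsT T (hs i))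

theorem tendsto_average {k : ℕ} {φ : (Fin k → E d) → ℝ}
    (hφ : Continuous φ) {C : ℝ} (hC : ∀ x, |φ x| ≤ C) (t : Fin k → I) (f : D d) :
    Tendsto (fun h => average φ t h f) (𝓝[>] 0) (𝓝 (φ fun i => f (t i))) := by
  have hlim : ∀ s : I, Tendsto (fun h => φ fun i => f (shift h (t i) s)) (𝓝[>] 0)
      (𝓝 (φ fun i => f (t i))) := by
    refine fun s => (hφ.tendsto _).comp (tendsto_pi_nhds.2 fun i => ?_)
    refine (f.continuousWithinAt_Ici (t i)).tendsto.comp (tendsto_nhdsWithin_iff.2 ⟨?_, ?_⟩)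
    · refine Tendsto.mono_left (Continuous.tendsto' ?_ _ _ ?_) nhdsWithin_le_nhds
      · exact continuous_projIcc.comp (by fun_prop)
      · simp [shift]
    · filter_upwards [self_mem_nhdsWithin] with h hh using le_shift (le_of_lt hh) _ _
  have := tendsto_integral_filter_of_dominated_convergence (μ := (volume : Measure I))
    (F := fun h s => φ fun i => f (shift h (t i) s)) (f := fun _ => φ fun i => f (t i))
    (l := 𝓝[>] (0 : ℝ)) (fun _ => C) (Eventually.of_forall fun h =>
      (hφ.measurable.comp (measurable_pi_lambda _ fun i =>
        f.measurable.comp (continuous_shift h (t i)).measurable)).aestronglyMeasurable)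
    (Eventually.of_forall fun h => ae_of_all _ fun s => hC _) (integrable_const _)
    (ae_of_all _ hlim)
  simpa [average] using this

/-! ### Measurability for the evaluation σ-algebra. -/

theorem measurable_eval (t : I) : Measurable fun f : D d => f t := by
  rw [measurable_iff_comap_le]
  exact le_iSup (fun t : I => MeasurableSpace.comap (fun f : D d => f t) inferInstance) t

theorem tendsto_floor_add_one_div {x : ℝ} (hx : 0 ≤ x) :
    Tendsto (fun m : ℕ => ((⌊(m : ℝ) * x⌋₊ : ℝ) + 1) / m) atTop (𝓝 x) := by
  have h0 : Tendsto (fun m : ℕ => x + 1 / (m : ℝ)) atTop (𝓝 x) := by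
    simpa using (tendsto_const_nhds (x := x)).add (tendsto_one_div_atTop_nhds_zero_nat (𝕜 := ℝ))
  refine tendsto_of_tendsto_of_tendsto_of_le_of_le' tendsto_const_nhds h0 ?_ ?_
  · filter_upwards [eventually_gt_atTop 0] with m hm
    have hm' : (0 : ℝ) < m := by exact_mod_cast hm
    rw [le_div_iff₀' hm']
    exact (Nat.lt_floor_add_one _).le
  · filter_upwards [eventually_gt_atTop 0] with m hm
    have hm' : (0 : ℝ) < m := by exact_mod_cast hm
    rw [div_le_iff₀' hm', mul_add, mul_one_div_cancel hm'.ne']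
    gcongr
    exact Nat.floor_le (by positivity)

/-- Grid points approaching the time from the right make this a limit of countably valued time
samplings, by right continuity. -/
theorem measurable_eval_uncurry : Measurable fun p : I × D d => p.2 p.1 := by
  let q : ℕ → ℕ → I := fun m k => Set.projIcc 0 1 zero_le_one (((k : ℝ) + 1) / m)
  refine measurable_of_tendsto_metrizable
    (f := fun (m : ℕ) (p : I × D d) => p.2 (q m ⌊(m : ℝ) * p.1⌋₊)) (fun m => ?_) ?_
  · have h1 : Measurable fun p : ℕ × D d => p.2 (q m p.1) :=
      measurable_from_prod_countable_right fun k => measurable_eval (q m k)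
    have h2 : Measurable fun p : I × D d => (⌊(m : ℝ) * p.1⌋₊, p.2) := by fun_prop
    exact h1.comp h2
  · rw [tendsto_pi_nhds]
    rintro ⟨t, f⟩
    refine (f.continuousWithinAt_Ici t).tendsto.comp (tendsto_nhdsWithin_iff.2 ⟨?_, ?_⟩)
    · have h1 := (continuous_projIcc (h := zero_le_one' ℝ)).tendsto (t : ℝ)
      rw [Set.projIcc_val] at h1
      exact h1.comp (tendsto_floor_add_one_div t.2.1)
    · filter_upwards [eventually_gt_atTop 0] with m hm
      have hm' : (0 : ℝ) < m := by exact_mod_cast hm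
      have h1 : (t : ℝ) ≤ ((⌊(m : ℝ) * t⌋₊ : ℝ) + 1) / m := by
        rw [le_div_iff₀' hm']
        exact (Nat.lt_floor_add_one _).le
      calc t = Set.projIcc 0 1 zero_le_one (t : ℝ) := (Set.projIcc_val _ _).symm
        _ ≤ _ := Set.monotone_projIcc _ h1

theorem measurable_excess (R : ℝ) : Measurable (excess R : D d → ℝ) := by
  obtain ⟨S, hSc, hSd⟩ := TopologicalSpace.exists_countable_dense I
  have : Countable S := hSc.to_subtype
  have : Nonempty S := hSd.nonempty.to_subtype
  have key : (excess R : D d → ℝ) = fun f => ⨆ t : S, min 1 (max 0 (‖f t‖ - R)) := by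
    funext f
    have hb : BddAbove (Set.range fun t : S => min 1 (max 0 (‖f t‖ - R))) :=
      ⟨1, by rintro _ ⟨t, rfl⟩; exact min_le_left _ _⟩
    set K := {x : E d | min 1 (max 0 (‖x‖ - R)) ≤ ⨆ t : S, min 1 (max 0 (‖f t‖ - R))}
    have hK : IsClosed K := isClosed_le (by fun_prop) continuous_const
    have hS : ∀ t ∈ S, f t ∈ K := fun t ht => le_ciSup hb ⟨t, ht⟩
    refine le_antisymm (ciSup_le fun t => ?_) (ciSup_le fun t => le_excess R f t)
    change f t ∈ K
    rcases eq_or_lt_of_le (unitInterval.le_one' (t := t)) with rfl | ht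
    · have h1 : (1 : I) ∈ closure S := hSd 1
      rw [mem_closure_iff_frequently] at h1
      exact hK.mem_of_frequently_of_tendsto (h1.mono hS) f.continuousAt_one
    · refine hK.mem_of_frequently_of_tendsto (b := 𝓝[>] t) ?_ (f.right_continuous t)
      have h1 : t ∈ closure (Set.Ioi t ∩ S) := by
        refine closure_minimal (hSd.open_subset_closure_inter isOpen_Ioi) isClosed_closure ?_
        rw [closure_Ioi' (a := t) ⟨1, ht⟩]
        exact Set.self_mem_Ici
      rw [mem_closure_iff_frequently] at h1
      rw [frequently_nhdsWithin_iff]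
      exact h1.mono fun s hs => ⟨hS s hs.2, hs.1⟩
  rw [key]
  refine Measurable.iSup fun t => ?_
  have := measurable_eval (d := d) (t : I)
  fun_prop

/-! ### Two-time laws of a Markov chain. -/

instance isMarkovKernel_pow {S : Type*} [MeasurableSpace S] (κ : Kernel S S) [IsMarkovKernel κ]
    (j : ℕ) : IsMarkovKernel (κ ^ j) := by
  induction j with
  | zero => exact inferInstanceAs (IsMarkovKernel Kernel.id)
  | succ j ih => rw [pow_succ]; exact inferInstanceAs (IsMarkovKernel ((κ ^ j) ∘ₖ κ))

/-- Induction on `j`, tested on rectangles: the event `Y k ∈ A` belongs to the past at time `k + j`,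
so the one-step Markov property can be integrated over it. -/
theorem IsMarkovChain.map_prodMk {Ω S : Type*} [MeasurableSpace Ω] [MeasurableSpace S]
    {P : Measure Ω} [IsProbabilityMeasure P] {κ : Kernel S S} [IsMarkovKernel κ]
    {Y : ℕ → Ω → S} (hY : IsMarkovChain P κ Y) (k j : ℕ) :
    P.map (fun ω => (Y k ω, Y (k + j) ω)) = P.map (Y k) ⊗ₘ (κ ^ j) := by
  have hm := hY.1
  have hprob : IsProbabilityMeasure (P.map (Y k)) := Measure.isProbabilityMeasure_map
    (hm k).aemeasurable
  induction j with
  | zero =>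
    have : κ ^ 0 = Kernel.id := rfl
    rw [this, Measure.compProd_id, Measure.map_map (by fun_prop) (hm k)]
    rfl
  | succ j ih =>
    have hpair : Measurable fun ω => (Y k ω, Y (k + j) ω) := (hm k).prodMk (hm (k + j))
    have : IsProbabilityMeasure (P.map fun ω => (Y k ω, Y (k + (j + 1)) ω)) :=
      Measure.isProbabilityMeasure_map ((hm k).prodMk (hm _)).aemeasurable
    refine Measure.ext_prod fun {A B} hA hB => ?_
    have hpow : ∀ x, (κ ^ (j + 1)) x B = ∫⁻ y, κ y B ∂(κ ^ j) x := fun x =>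
      Kernel.pow_succ_apply_eq_lintegral κ j x hB
    have hκB : Measurable fun y => κ y B := κ.measurable_coe hB
    have hstep : P (Y k ⁻¹' A ∩ Y (k + j + 1) ⁻¹' B)
        = ∫⁻ ω in Y k ⁻¹' A, κ (Y (k + j) ω) B ∂P := by
      have hle : (⨆ i : Fin (k + j + 1), MeasurableSpace.comap (Y i) inferInstance)
          ≤ (inferInstance : MeasurableSpace Ω) := iSup_le fun i => (hm i).comap_le
      have hAm : MeasurableSet[⨆ i : Fin (k + j + 1), MeasurableSpace.comap (Y i) inferInstance]
          (Y k ⁻¹' A) :=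
        le_iSup (fun i : Fin (k + j + 1) => MeasurableSpace.comap (Y i) inferInstance)
          ⟨k, by omega⟩ _ ⟨A, hA, rfl⟩
      have hBm : MeasurableSet (Y (k + j + 1) ⁻¹' B) := hm _ hB
      have h1 := setIntegral_condExp hle
        ((integrable_const (1 : ℝ)).indicator (μ := P) hBm) hAm
      rw [setIntegral_congr_ae (hle _ hAm) ((hY.2 (k + j) B hB).mono fun ω h _ => h),
        integral_indicator_const _ hBm] at h1
      have h2 : ∫ ω in Y k ⁻¹' A, (κ (Y (k + j) ω)).real B ∂P
          = (∫⁻ ω in Y k ⁻¹' A, κ (Y (k + j) ω) B ∂P).toReal :=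
        integral_toReal (hκB.comp (hm _)).aemeasurable
          (ae_of_all _ fun ω => measure_lt_top _ _)
      have hfin : ∫⁻ ω in Y k ⁻¹' A, κ (Y (k + j) ω) B ∂P ≠ ∞ := by
        refine ne_top_of_le_ne_top (measure_ne_top P (Y k ⁻¹' A)) ?_
        calc _ ≤ ∫⁻ ω in Y k ⁻¹' A, 1 ∂P := lintegral_mono fun ω => prob_le_one
          _ = _ := by simp
      rw [h2, smul_eq_mul, mul_one, Measure.real, Measure.restrict_apply hBm,
        ENNReal.toReal_eq_toReal_iff' hfin (measure_ne_top _ _), Set.inter_comm] at h1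
      exact h1.symm
    rw [Measure.map_apply ((hm k).prodMk (hm _)) (hA.prod hB), Measure.compProd_apply_prod hA hB]
    simp_rw [hpow]
    calc _ = ∫⁻ ω in Y k ⁻¹' A, κ (Y (k + j) ω) B ∂P := hstep
      _ = ∫⁻ p in A ×ˢ Set.univ, κ p.2 B ∂(P.map fun ω => (Y k ω, Y (k + j) ω)) := by
        rw [setLIntegral_map (hA.prod .univ) (by fun_prop) hpair]
        congr 2
        ext ω
        simp
      _ = _ := by
        rw [ih, Measure.setLIntegral_compProd (by fun_prop) hA .univ]
        simp

/-- Disintegrate over `Y k`; outside the ball of radius `R` the transition probability is bounded by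
`1`. -/
theorem IsMarkovChain.measure_norm_sub_le {Ω : Type*} [MeasurableSpace Ω]
    {P : Measure Ω} [IsProbabilityMeasure P] {κ : Kernel (E d) (E d)} [IsMarkovKernel κ]
    {Y : ℕ → Ω → E d} (hY : IsMarkovChain P κ Y) (k j : ℕ) {ε R : ℝ} {b : ℝ≥0∞}
    (hb : ∀ x, ‖x‖ < R → (κ ^ j) x {y | ε < ‖y - x‖} ≤ b) :
    P {ω | ε < ‖Y (k + j) ω - Y k ω‖} ≤ P {ω | R ≤ ‖Y k ω‖} + b := by
  have hm := hY.1
  have hprob : IsProbabilityMeasure (P.map (Y k)) := Measure.isProbabilityMeasure_map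
    (hm k).aemeasurable
  have hS : MeasurableSet {p : E d × E d | ε < ‖p.2 - p.1‖} :=
    measurableSet_lt measurable_const (by fun_prop)
  have hR : MeasurableSet {x : E d | R ≤ ‖x‖} := measurableSet_le measurable_const (by fun_prop)
  calc P {ω | ε < ‖Y (k + j) ω - Y k ω‖}
      = P.map (fun ω => (Y k ω, Y (k + j) ω)) {p | ε < ‖p.2 - p.1‖} :=
        (Measure.map_apply ((hm k).prodMk (hm _)) hS).symm
    _ = ∫⁻ x, (κ ^ j) x {y | ε < ‖y - x‖} ∂(P.map (Y k)) := by
        rw [hY.map_prodMk, Measure.compProd_apply hS]; rfl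
    _ ≤ ∫⁻ x, {x | R ≤ ‖x‖}.indicator 1 x + b ∂(P.map (Y k)) := by
        refine lintegral_mono fun x => ?_
        rcases lt_or_ge ‖x‖ R with h | h
        · exact (hb x h).trans le_add_self
        · have h1 : {x : E d | R ≤ ‖x‖}.indicator (1 : E d → ℝ≥0∞) x = 1 :=
            Set.indicator_of_mem (s := {x : E d | R ≤ ‖x‖}) h _
          exact prob_le_one.trans (h1 ▸ le_self_add)
    _ = P {ω | R ≤ ‖Y k ω‖} + b := by
        rw [lintegral_add_right _ measurable_const, lintegral_indicator_one hR,
          Measure.map_apply (hm k) hR]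
        simp

/-! ### Embeddings compared with the underlying sequence. -/

theorem EmbeddingRule.norm_sub_le {T : SkorokhodTopology} {n k : ℕ} {a b x : E d} {t : I}
    (hn : 0 < n) (h1 : (k : ℝ) / n < t) (h2 : (t : ℝ) < (k + 1) / n)
    (h : EmbeddingRule T n k a b t x) : ‖x - a‖ ≤ ‖b - a‖ := by
  have hn' : (0 : ℝ) < n := by exact_mod_cast hn
  cases T with
  | J1 => simp [show x = a from h]
  | J2 => rcases h with rfl | rfl <;> simp
  | M1 =>
    rw [div_lt_iff₀' hn'] at h1
    rw [lt_div_iff₀' hn'] at h2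
    rw [show x = a + ((n : ℝ) * t - k) • (b - a) from h, add_sub_cancel_left, norm_smul,
      Real.norm_of_nonneg (by linarith)]
    exact mul_le_of_le_one_left (norm_nonneg _) (by linarith)
  | M2 =>
    have h3 : segment ℝ a b ⊆ Metric.closedBall a ‖b - a‖ :=
      (convex_closedBall _ _).segment_subset (Metric.mem_closedBall_self (norm_nonneg _))
        (by rw [Metric.mem_closedBall, dist_eq_norm])
    simpa [dist_eq_norm] using h3 h

/-- The index of the value of the step function embedding at time `t`. -/
def stepIndex (n : ℕ) (t : I) : ℕ := min ⌊(n : ℝ) * t⌋₊ (n - 1)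

theorem stepIndex_lt {n : ℕ} (hn : 0 < n) (t : I) : stepIndex n t < n :=
  (min_le_right _ _).trans_lt (Nat.sub_lt hn one_pos)

theorem IsEmbedding.norm_sub_stepIndex_le {T : SkorokhodTopology} {n : ℕ} {y : ℕ → E d} {x : D d}
    (h : IsEmbedding T n y x) (hn : 0 < n) (t : I) :
    ‖x t - y (stepIndex n t)‖ ≤ ‖y (stepIndex n t + 1) - y (stepIndex n t)‖ := by
  have hn' : (0 : ℝ) < n := by exact_mod_cast hn
  have key : ∀ k < n, ∀ s : I, (k : ℝ) / n ≤ s → (s : ℝ) < (k + 1) / n →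
      ‖x s - y k‖ ≤ ‖y (k + 1) - y k‖ := by
    intro k hk s h1 h2
    rcases h1.eq_or_lt with h1 | h1
    · simp [(h k hk).1 s h1.symm]
    · exact ((h k hk).2 s h1 h2).norm_sub_le hn h1 h2
  have hnt : 0 ≤ (n : ℝ) * t := mul_nonneg hn'.le t.2.1
  -- The embedding rule does not reach `t = 1`; there the bound is inherited through left
  -- continuity.
  rcases eq_or_lt_of_le (unitInterval.le_one' (t := t)) with rfl | ht
  · have h1 : stepIndex n 1 = n - 1 := by simp [stepIndex]
    rw [h1]
    have hlim : Tendsto (fun s : I => ‖x s - y (n - 1)‖) (𝓝[<] 1) (𝓝 ‖x 1 - y (n - 1)‖) :=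
      (x.left_continuous_one.sub_const _).norm
    have hne : (𝓝[<] (1 : I)).NeBot := nhdsLT_neBot_of_exists_lt ⟨0, zero_lt_one⟩
    refine le_of_tendsto hlim ?_
    have hc : Tendsto (fun s : I => (n : ℝ) * s) (𝓝[<] 1) (𝓝 (n : ℝ)) :=
      Continuous.tendsto' (by fun_prop) 1 _ (by simp) |>.mono_left nhdsWithin_le_nhds
    filter_upwards [hc.eventually_const_lt (sub_one_lt (n : ℝ)), self_mem_nhdsWithin] with s h2 h3
    have hcast : ((n - 1 : ℕ) : ℝ) = n - 1 := by rw [Nat.cast_sub hn, Nat.cast_one]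
    refine key (n - 1) (Nat.sub_lt hn one_pos) s ?_ ?_
    · rw [div_le_iff₀' hn', hcast]
      exact h2.le
    · rw [lt_div_iff₀' hn', hcast, sub_add_cancel]
      exact mul_lt_of_lt_one_right hn' h3
  · have h1 : ⌊(n : ℝ) * t⌋₊ < n :=
      (Nat.floor_lt hnt).2 (mul_lt_of_lt_one_right hn' ht)
    have h2 : stepIndex n t = ⌊(n : ℝ) * t⌋₊ := min_eq_left (by omega)
    rw [h2]
    refine key _ h1 t ?_ ?_
    · rw [div_le_iff₀' hn']
      exact Nat.floor_le hnt
    · rw [lt_div_iff₀' hn']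
      exact Nat.lt_floor_add_one _

theorem stepIndex_shift {n : ℕ} {h : ℝ} (hh : 0 ≤ h) (t s : I) :
    ∃ j : ℕ, stepIndex n (shift h t s) = stepIndex n t + j ∧ (j : ℝ) ≤ n * h + 1 := by
  have hnt : 0 ≤ (n : ℝ) * t := mul_nonneg n.cast_nonneg t.2.1
  have h1 : ⌊(n : ℝ) * t⌋₊ ≤ ⌊(n : ℝ) * shift h t s⌋₊ :=
    Nat.floor_mono (mul_le_mul_of_nonneg_left (le_shift hh t s) n.cast_nonneg)
  obtain ⟨i, hi⟩ := Nat.exists_eq_add_of_le h1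
  -- The extra `1` pays for rounding down at the earlier time.
  have h2 : (i : ℝ) ≤ n * h + 1 := by
    have h3 : (⌊(n : ℝ) * shift h t s⌋₊ : ℝ) ≤ n * shift h t s :=
      Nat.floor_le (mul_nonneg n.cast_nonneg (shift h t s).2.1)
    have h4 : (shift h t s : ℝ) ≤ t + h := by
      rw [coe_shift hh]
      exact (min_le_right _ _).trans (by gcongr; exact mul_le_of_le_one_right hh s.2.2)
    have h5 := Nat.lt_floor_add_one ((n : ℝ) * t)
    have h6 := mul_le_mul_of_nonneg_left h4 n.cast_nonneg
    rw [hi] at h3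
    push_cast at h3
    linarith
  refine ⟨stepIndex n (shift h t s) - stepIndex n t, ?_, le_trans ?_ h2⟩
  · simp only [stepIndex]
    omega
  · rw [Nat.cast_le]
    simp only [stepIndex]
    omega

/-! ### Uniform smallness of short increments. -/

theorem TightnessCondition.eventually_le {κ : ℕ → Kernel (E d) (E d)} (h : TightnessCondition κ)
    {ε R : ℝ} (hε : 0 < ε) (hR : 0 < R) {η : ℝ≥0∞} (hη : 0 < η) :
    ∃ r : ℝ, 0 < r ∧ ∀ᶠ n : ℕ in atTop, ∀ (x : E d) (j : ℕ), ‖x‖ < R → (j : ℝ) ≤ n * r →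
      (κ n ^ j) x {y | ε < ‖y - x‖} ≤ η := by
  obtain ⟨r, hlt, hr⟩ := (((h ε hε R hR).eventually_lt_const hη).and self_mem_nhdsWithin).exists
  refine ⟨r, hr, ?_⟩
  filter_upwards [eventually_lt_of_limsup_lt hlt, eventually_gt_atTop 0] with n hn hn0 x j hx hj
  have hn' : (0 : ℝ) < n := by exact_mod_cast hn0
  have hfl : ⌊(j : ℝ) / n * n⌋₊ = j := by rw [div_mul_cancel₀ _ hn'.ne', Nat.floor_natCast]
  refine le_trans ?_ hn.le
  refine le_iSup₂_of_le x hx (le_iSup₂_of_le ((j : ℝ) / n) ⟨by positivity, ?_⟩ ?_)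
  · rwa [div_le_iff₀' hn']
  · rw [hfl]

section Chain

variable {Ω : Type*} [MeasurableSpace Ω] {P : Measure Ω} [IsProbabilityMeasure P]
  {T : SkorokhodTopology} {κ : ℕ → Kernel (E d) (E d)} [∀ n, IsMarkovKernel (κ n)]
  {Y : ℕ → ℕ → Ω → E d} {XT : ℕ → Ω → D d} {X : Ω → D d}

theorem integrable_excess {Z : Ω → D d} (hZ : Measurable Z) (R : ℝ) :
    Integrable (fun ω => excess R (Z ω)) P :=
  Integrable.of_bound ((measurable_excess R).comp hZ).aestronglyMeasurable 1
    (ae_of_all _ fun ω => by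
      rw [Real.norm_of_nonneg (excess_nonneg _ _)]; exact excess_le_one _ _)

theorem TendstoInDist.exists_eventually_measure_le (hXT : ∀ n, Measurable (XT n))
    (hX : Measurable X) (hconv : TendstoInDist T P XT X) {η : ℝ≥0∞} (hη : 0 < η) :
    ∃ R : ℝ, 0 < R ∧ ∀ᶠ n in atTop, ∀ t, P {ω | R ≤ ‖XT n ω t‖} ≤ η := by
  have h0 : Tendsto (fun R : ℕ => ∫ ω, excess R (X ω) ∂P) atTop (𝓝 0) := by
    have := tendsto_integral_of_dominated_convergence (μ := P)
      (F := fun (R : ℕ) ω => excess R (X ω)) (f := fun _ => 0) (fun _ => 1)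
      (fun R => (integrable_excess hX R).aestronglyMeasurable) (integrable_const _)
      (fun R => ae_of_all _ fun ω => by
        rw [Real.norm_of_nonneg (excess_nonneg _ _)]; exact excess_le_one _ _)
      (ae_of_all _ fun ω => by
        obtain ⟨C, hC⟩ := (X ω).exists_norm_le
        obtain ⟨m, hm⟩ := exists_nat_ge C
        refine tendsto_nhds_of_eventually_eq ?_
        filter_upwards [eventually_ge_atTop m] with R hR
        exact excess_eq_zero fun t => (hC t).trans (hm.trans (by exact_mod_cast hR)))
    simpa using this
  have h0' : Tendsto (fun R : ℕ => ENNReal.ofReal (∫ ω, excess R (X ω) ∂P)) atTop (𝓝 0) := by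
    simpa using ENNReal.tendsto_ofReal h0
  obtain ⟨R, hR⟩ := (h0'.eventually_lt_const hη).exists
  -- A norm of at least `R + 1` saturates the truncation, so Markov's inequality at level `1`
  -- applies.
  refine ⟨R + 1, by positivity, ?_⟩
  have h1 := ENNReal.tendsto_ofReal (hconv (excess R)
    ⟨1, fun f => by rw [abs_of_nonneg (excess_nonneg _ _)]; exact excess_le_one _ _⟩
    (isContinuous_excess T R))
  filter_upwards [h1.eventually_lt_const hR] with n hn t
  refine le_trans ?_ hn.le
  have h2 := mul_meas_ge_le_integral_of_nonneg (μ := P)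
    (ae_of_all _ fun ω => excess_nonneg R (XT n ω)) (integrable_excess (hXT n) R) 1
  rw [one_mul] at h2
  calc P {ω | (R : ℝ) + 1 ≤ ‖XT n ω t‖} ≤ P {ω | 1 ≤ excess R (XT n ω)} := by
        refine measure_mono fun ω hω => ?_
        have hω' : (R : ℝ) + 1 ≤ ‖XT n ω t‖ := hω
        refine le_trans ?_ (le_excess (R : ℝ) (XT n ω) t)
        exact le_min le_rfl (le_max_of_le_right (by linarith))
    _ = ENNReal.ofReal (P.real {ω | 1 ≤ excess R (XT n ω)}) := by simp
    _ ≤ _ := ENNReal.ofReal_le_ofReal h2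

/-- For `k < n` the chain is the embedding sampled at `k/n`, so the uniform bound on `XT` confines
the starting points. -/
theorem exists_eventually_increment_le (hY : ∀ n, IsMarkovChain P (κ n) (Y n))
    (hXT : ∀ n, Measurable (XT n))
    (hemb : ∀ n ω, IsEmbedding T n (fun k => Y n k ω) (XT n ω)) (hX : Measurable X)
    (htight : TightnessCondition κ) (hconv : TendstoInDist T P XT X)
    {ε : ℝ} (hε : 0 < ε) {η : ℝ≥0∞} (hη : 0 < η) :
    ∃ r : ℝ, 0 < r ∧ ∀ᶠ n : ℕ in atTop, ∀ k j : ℕ, k < n → (j : ℝ) ≤ n * r →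
      P {ω | ε < ‖Y n (k + j) ω - Y n k ω‖} ≤ η := by
  obtain ⟨R, hR, h1⟩ := hconv.exists_eventually_measure_le hXT hX (ENNReal.half_pos hη.ne')
  obtain ⟨r, hr, h2⟩ := htight.eventually_le hε hR (ENNReal.half_pos hη.ne')
  refine ⟨r, hr, ?_⟩
  filter_upwards [h1, h2] with n h1 h2 k j hk hj
  have hn' : (0 : ℝ) < n := by exact_mod_cast (Nat.zero_le k).trans_lt hk
  have hk' : (k : ℝ) / n ∈ I := ⟨by positivity, (div_le_one hn').2 (by exact_mod_cast hk.le)⟩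
  have h3 := h1 ⟨k / n, hk'⟩
  simp only [fun ω => (hemb n ω k hk).1 ⟨k / n, hk'⟩ rfl] at h3
  calc _ ≤ _ := (hY n).measure_norm_sub_le k j fun x hx => h2 x j hx hj
    _ ≤ η / 2 + η / 2 := by gcongr
    _ = η := ENNReal.add_halves η

theorem eventually_embedding_sub_le (hY : ∀ n, IsMarkovChain P (κ n) (Y n))
    (hXT : ∀ n, Measurable (XT n))
    (hemb : ∀ n ω, IsEmbedding T n (fun k => Y n k ω) (XT n ω)) (hX : Measurable X)
    (htight : TightnessCondition κ) (hconv : TendstoInDist T P XT X)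
    {ε : ℝ} (hε : 0 < ε) {η : ℝ≥0∞} (hη : 0 < η) :
    ∀ᶠ n : ℕ in atTop, ∀ t, P {ω | ε < ‖XT n ω t - Y n (stepIndex n t) ω‖} ≤ η := by
  obtain ⟨r, hr, h⟩ := exists_eventually_increment_le hY hXT hemb hX htight hconv hε hη
  have hlarge : ∀ᶠ n : ℕ in atTop, 1 ≤ (n : ℝ) * r :=
    (tendsto_natCast_atTop_atTop.atTop_mul_const hr).eventually_ge_atTop 1
  filter_upwards [h, hlarge, eventually_gt_atTop 0] with n h h1 hn t
  refine (measure_mono fun ω hω => ?_).trans (h (stepIndex n t) 1 (stepIndex_lt hn t) (by simpa))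
  exact lt_of_lt_of_le hω ((hemb n ω).norm_sub_stepIndex_le hn t)

theorem exists_eventually_shift_sub_le (hY : ∀ n, IsMarkovChain P (κ n) (Y n))
    (hXT : ∀ n, Measurable (XT n))
    (hemb : ∀ n ω, IsEmbedding T n (fun k => Y n k ω) (XT n ω)) (hX : Measurable X)
    (htight : TightnessCondition κ) (hconv : TendstoInDist T P XT X)
    {ε : ℝ} (hε : 0 < ε) {η : ℝ≥0∞} (hη : 0 < η) :
    ∃ r : ℝ, 0 < r ∧ ∀ h : ℝ, 0 ≤ h → h ≤ r → ∀ᶠ n : ℕ in atTop, ∀ t s,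
      P {ω | ε < ‖XT n ω t - XT n ω (shift h t s)‖} ≤ η := by
  have hε' : 0 < ε / 3 := by positivity
  have hη' : 0 < η / 3 := ENNReal.div_pos hη.ne' (by simp)
  obtain ⟨r, hr, hinc⟩ := exists_eventually_increment_le hY hXT hemb hX htight hconv hε' hη'
  -- Half of `r` is reserved for the rounding term: `n * h + 1 ≤ n * r` once `n * r ≥ 2`.
  refine ⟨r / 2, half_pos hr, fun h hh hhr => ?_⟩
  have hlarge : ∀ᶠ n : ℕ in atTop, 2 ≤ (n : ℝ) * r :=
    (tendsto_natCast_atTop_atTop.atTop_mul_const hr).eventually_ge_atTop 2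
  filter_upwards [hinc, eventually_embedding_sub_le hY hXT hemb hX htight hconv hε' hη', hlarge,
    eventually_gt_atTop 0] with n h1 h2 h3 hn t s
  obtain ⟨j, hj, hjle⟩ := stepIndex_shift (n := n) hh t s
  have h4 : (j : ℝ) ≤ n * r := by
    have := mul_le_mul_of_nonneg_left hhr (n.cast_nonneg (α := ℝ))
    linarith
  have h5 := h1 (stepIndex n t) j (stepIndex_lt hn t) h4
  have h6 := h2 t
  have h7 := h2 (shift h t s)
  rw [hj] at h7
  calc P {ω | ε < ‖XT n ω t - XT n ω (shift h t s)‖}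
      ≤ P ({ω | ε / 3 < ‖XT n ω t - Y n (stepIndex n t) ω‖} ∪
          {ω | ε / 3 < ‖Y n (stepIndex n t + j) ω - Y n (stepIndex n t) ω‖} ∪
          {ω | ε / 3 < ‖XT n ω (shift h t s) - Y n (stepIndex n t + j) ω‖}) := by
        refine measure_mono fun ω hω => ?_
        by_contra hnot
        simp only [Set.mem_union, Set.mem_ofPred_eq, not_or, not_lt] at hnot hω
        obtain ⟨⟨ha, hb⟩, hc⟩ := hnot
        have h8 := norm_sub_le_norm_sub_add_norm_sub (XT n ω t) (Y n (stepIndex n t) ω)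
          (XT n ω (shift h t s))
        have h9 := norm_sub_le_norm_sub_add_norm_sub (Y n (stepIndex n t) ω)
          (Y n (stepIndex n t + j) ω) (XT n ω (shift h t s))
        rw [norm_sub_rev (Y n (stepIndex n t) ω) (Y n (stepIndex n t + j) ω),
          norm_sub_rev (Y n (stepIndex n t + j) ω) (XT n ω (shift h t s))] at h9
        linarith
    _ ≤ η / 3 + η / 3 + η / 3 :=
        (measure_union_le _ _).trans (add_le_add ((measure_union_le _ _).trans
          (add_le_add h6 h5)) h7)
    _ = η := ENNReal.add_thirds η

end Chain

/-! ### Convergence of finite-dimensional distributions. -/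

section Chain

variable {Ω : Type*} [MeasurableSpace Ω] {P : Measure Ω} [IsProbabilityMeasure P]
  {T : SkorokhodTopology} {κ : ℕ → Kernel (E d) (E d)} [∀ n, IsMarkovKernel (κ n)]
  {Y : ℕ → ℕ → Ω → E d} {XT : ℕ → Ω → D d} {X : Ω → D d}

theorem measurable_tuple {Z : Ω → D d} (hZ : Measurable Z) {k : ℕ} (t : Fin k → I) :
    Measurable fun ω (i : Fin k) => Z ω (t i) :=
  measurable_pi_lambda _ fun i => (measurable_eval (t i)).comp hZ

theorem measurable_shift_tuple {Z : Ω → D d} (hZ : Measurable Z) {k : ℕ} (t : Fin k → I)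
    (h : ℝ) : Measurable fun (p : Ω × I) (i : Fin k) => Z p.1 (shift h (t i) p.2) :=
  measurable_pi_lambda _ fun i => measurable_eval_uncurry.comp
    (((continuous_shift h (t i)).measurable.comp measurable_snd).prodMk (hZ.comp measurable_fst))

/-- If all coordinates are `ε`-close, the Lipschitz bound applies; otherwise the bound `2 * C` is
charged to a bad coordinate. -/
theorem norm_integral_lipschitz_sub_le {k : ℕ} {A B : Ω → Fin k → E d} (hA : Measurable A)
    (hB : Measurable B) {φ : (Fin k → E d) → ℝ} {L : NNReal} (hL : LipschitzWith L φ) {C : ℝ}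
    (hC : ∀ x, |φ x| ≤ C) {ε η : ℝ} (hε : 0 ≤ ε)
    (h : ∀ i, P {ω | ε < ‖A ω i - B ω i‖} ≤ ENNReal.ofReal η) (hη : 0 ≤ η) :
    ‖∫ ω, (φ (A ω) - φ (B ω)) ∂P‖ ≤ L * ε + k * (2 * C * η) := by
  have hC0 : 0 ≤ C := (abs_nonneg _).trans (hC 0)
  have hS : ∀ i, MeasurableSet {ω | ε < ‖A ω i - B ω i‖} := fun i =>
    measurableSet_lt measurable_const
      (((measurable_pi_apply i).comp hA).sub ((measurable_pi_apply i).comp hB)).norm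
  have hint : ∀ i, Integrable ({ω | ε < ‖A ω i - B ω i‖}.indicator fun _ => 2 * C) P :=
    fun i => (integrable_const _).indicator (hS i)
  have hsum := integrable_finsetSum Finset.univ fun i (_ : i ∈ Finset.univ) => hint i
  have hpt : ∀ ω, ‖φ (A ω) - φ (B ω)‖ ≤
      L * ε + ∑ i, {ω | ε < ‖A ω i - B ω i‖}.indicator (fun _ => 2 * C) ω := by
    intro ω
    have hnn : ∀ i, 0 ≤ {ω | ε < ‖A ω i - B ω i‖}.indicator (fun _ => 2 * C) ω := fun i =>
      Set.indicator_nonneg (fun _ _ => by positivity) _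
    by_cases hω : ∃ i, ε < ‖A ω i - B ω i‖
    · obtain ⟨i, hi⟩ := hω
      have h1 : {ω | ε < ‖A ω i - B ω i‖}.indicator (fun _ => 2 * C) ω = 2 * C :=
        Set.indicator_of_mem (s := {ω | ε < ‖A ω i - B ω i‖}) hi _
      have h2 := Finset.single_le_sum (fun i _ => hnn i) (Finset.mem_univ i)
      have h3 : ‖φ (A ω) - φ (B ω)‖ ≤ 2 * C := by
        refine (norm_sub_le _ _).trans ?_
        rw [Real.norm_eq_abs, Real.norm_eq_abs]
        linarith [hC (A ω), hC (B ω)]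
      have h4 : 0 ≤ (L : ℝ) * ε := by positivity
      linarith
    · push Not at hω
      have h1 : ‖φ (A ω) - φ (B ω)‖ ≤ L * ε :=
        hL.norm_sub_le_of_le ((pi_norm_le_iff_of_nonneg hε).2 hω)
      linarith [Finset.sum_nonneg fun i (_ : i ∈ Finset.univ) => hnn i]
  calc _ ≤ ∫ ω, (L * ε + ∑ i, {ω | ε < ‖A ω i - B ω i‖}.indicator (fun _ => 2 * C) ω) ∂P :=
        norm_integral_le_of_norm_le ((integrable_const _).add hsum) (ae_of_all _ hpt)
    _ = L * ε + ∑ i, P.real {ω | ε < ‖A ω i - B ω i‖} * (2 * C) := by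
        rw [integral_add (integrable_const _) hsum, integral_finsetSum _ fun i _ => hint i]
        simp [integral_indicator_const _ (hS _)]
    _ ≤ L * ε + ∑ i : Fin k, η * (2 * C) := by
        gcongr with i
        exact ENNReal.toReal_le_of_le_ofReal hη (h i)
    _ = _ := by
        simp only [Finset.sum_const, Finset.card_univ, Fintype.card_fin, nsmul_eq_mul]
        ring

/-- By Fubini, the closeness in probability may be used for each fixed `s` before averaging. -/
theorem abs_integral_sub_average_le {Z : Ω → D d} (hZ : Measurable Z) {k : ℕ} (t : Fin k → I)
    {φ : (Fin k → E d) → ℝ} {L : NNReal} (hL : LipschitzWith L φ) {C : ℝ}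
    (hC : ∀ x, |φ x| ≤ C) {ε η h : ℝ} (hε : 0 ≤ ε) (hη : 0 ≤ η)
    (hP : ∀ t s, P {ω | ε < ‖Z ω t - Z ω (shift h t s)‖} ≤ ENNReal.ofReal η) :
    |∫ ω, φ (fun i => Z ω (t i)) ∂P - ∫ ω, average φ t h (Z ω) ∂P|
      ≤ L * ε + k * (2 * C * η) := by
  have hφ := hL.continuous
  have hm := measurable_shift_tuple hZ t h
  have hint : Integrable (fun p : Ω × I => φ fun i => Z p.1 (shift h (t i) p.2))
      (P.prod volume) :=
    Integrable.of_bound (hφ.measurable.comp hm).aestronglyMeasurable C (ae_of_all _ fun p => hC _)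
  have h1 : ∫ ω, average φ t h (Z ω) ∂P
      = ∫ s : I, ∫ ω, φ (fun i => Z ω (shift h (t i) s)) ∂P :=
    integral_integral_swap (f := fun ω s => φ fun i => Z ω (shift h (t i) s)) hint
  have hint1 : Integrable (fun ω => φ fun i => Z ω (t i)) P :=
    Integrable.of_bound (hφ.measurable.comp (measurable_tuple hZ t)).aestronglyMeasurable C
      (ae_of_all _ fun p => hC _)
  have hms : ∀ s, Measurable fun ω (i : Fin k) => Z ω (shift h (t i) s) := fun s =>
    measurable_tuple hZ _
  have hint2 : ∀ s, Integrable (fun ω => φ fun i => Z ω (shift h (t i) s)) P := fun s =>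
    Integrable.of_bound (hφ.measurable.comp (hms s)).aestronglyMeasurable C
      (ae_of_all _ fun p => hC _)
  have h2 : ∫ ω, φ (fun i => Z ω (t i)) ∂P - ∫ ω, average φ t h (Z ω) ∂P
      = ∫ s : I, ∫ ω, (φ (fun i => Z ω (t i)) - φ (fun i => Z ω (shift h (t i) s))) ∂P := by
    simp_rw [fun s => integral_sub hint1 (hint2 s)]
    rw [integral_sub (integrable_const _) hint.integral_prod_right, h1]
    simp
  rw [h2, ← Real.norm_eq_abs]
  have h3 := norm_integral_le_of_norm_le_const (μ := (volume : Measure I)) (ae_of_all _ fun s =>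
    norm_integral_lipschitz_sub_le (P := P) (measurable_tuple hZ t) (hms s) hL hC hε
      (fun i => hP (t i) s) hη)
  simpa using h3

theorem tendstoFDD_univ (hY : ∀ n, IsMarkovChain P (κ n) (Y n)) (hXT : ∀ n, Measurable (XT n))
    (hemb : ∀ n ω, IsEmbedding T n (fun k => Y n k ω) (XT n ω)) (hX : Measurable X)
    (htight : TightnessCondition κ) (hconv : TendstoInDist T P XT X) :
    TendstoFDD P XT X Set.univ := by
  intro k t _
  refine ⟨fun n => (measurable_tuple (hXT n) t).aemeasurable,
    (measurable_tuple hX t).aemeasurable, ?_⟩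
  refine tendsto_iff_forall_lipschitz_integral_tendsto.2 ?_
  rintro φ ⟨M, hM⟩ ⟨L, hL⟩
  have hφ := hL.continuous
  simp only [ProbabilityMeasure.coe_mk]
  rw [integral_map (measurable_tuple hX t).aemeasurable hφ.aestronglyMeasurable]
  simp_rw [fun n => integral_map (μ := P) (measurable_tuple (hXT n) t).aemeasurable
    hφ.aestronglyMeasurable]
  set C : ℝ := |φ 0| + M
  have hC : ∀ x, |φ x| ≤ C := fun x => by
    have h1 := hM x 0
    rw [Real.dist_eq] at h1
    linarith [abs_sub_abs_le_abs_sub (φ x) (φ 0)]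
  have hC0 : 0 ≤ C := (abs_nonneg _).trans (hC 0)
  have hlim : Tendsto (fun h => ∫ ω, average φ t h (X ω) ∂P) (𝓝[>] 0)
      (𝓝 (∫ ω, φ (fun i => X ω (t i)) ∂P)) := by
    refine tendsto_integral_filter_of_dominated_convergence (fun _ => C)
      (Eventually.of_forall fun h => ?_) (Eventually.of_forall fun h => ae_of_all _ fun ω => ?_)
      (integrable_const _) (ae_of_all _ fun ω => tendsto_average hφ hC t (X ω))
    · exact ((hφ.measurable.comp (measurable_shift_tuple hX t h)).stronglyMeasurable
        |>.integral_prod_right').aestronglyMeasurable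
    · exact abs_average_le hC t h (X ω)
  rw [Metric.tendsto_nhds]
  intro δ hδ
  set ε : ℝ := δ / (4 * (L + 1))
  set η : ℝ := δ / (4 * (k * (2 * C) + 1))
  have hε : 0 < ε := by positivity
  have hη : 0 < η := by positivity
  have hsmall : L * ε + k * (2 * C * η) ≤ δ / 2 := by
    have h1 : L * ε ≤ δ / 4 := by
      rw [show L * ε = δ / 4 * (L / (L + 1)) by simp only [ε]; field_simp]
      exact mul_le_of_le_one_right (by positivity) ((div_le_one (by positivity)).2 (by linarith))
    have h2 : k * (2 * C * η) ≤ δ / 4 := by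
      rw [show k * (2 * C * η) = δ / 4 * (k * (2 * C) / (k * (2 * C) + 1)) by
        simp only [η]; field_simp]
      exact mul_le_of_le_one_right (by positivity) ((div_le_one (by positivity)).2 (by linarith))
    linarith
  obtain ⟨r, hr, hshift⟩ := exists_eventually_shift_sub_le hY hXT hemb hX htight hconv hε
    (ENNReal.ofReal_pos.2 hη)
  -- The window `h` is fixed before `n`: averaging costs `δ / 4` for `X` and `δ / 2` for `XT`, and
  -- convergence of the averages costs the remaining `δ / 4`.
  obtain ⟨h, h1, h0, h2⟩ := ((Metric.tendsto_nhds.1 hlim (δ / 4) (by positivity)).and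
    (Ioc_mem_nhdsGT hr)).exists
  have h3 := hconv (average φ t h)
    ⟨C, abs_average_le hC t h⟩ (isContinuous_average T hφ hC t h0)
  filter_upwards [hshift h h0.le h2, Metric.tendsto_nhds.1 h3 (δ / 4) (by positivity)]
    with n h4 h5
  have h6 := abs_integral_sub_average_le (hXT n) t hL hC hε.le hη.le h4
  rw [← Real.dist_eq] at h6
  have h7 := dist_triangle4 (∫ ω, φ (fun i => XT n ω (t i)) ∂P)
    (∫ ω, average φ t h (XT n ω) ∂P) (∫ ω, average φ t h (X ω) ∂P)
    (∫ ω, φ (fun i => X ω (t i)) ∂P)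
  linarith

theorem TendstoFDD.stepEmbedding (hY : ∀ n, IsMarkovChain P (κ n) (Y n))
    (hXT : ∀ n, Measurable (XT n))
    (hemb : ∀ n ω, IsEmbedding T n (fun k => Y n k ω) (XT n ω)) (hX : Measurable X)
    (htight : TightnessCondition κ) (hconv : TendstoInDist T P XT X) {S : Set I}
    (hS : TendstoFDD P XT X S) :
    TendstoFDD P (fun n ω => stepEmbedding n (fun k => Y n k ω)) X S := by
  intro k t ht
  refine tendstoInDistribution_of_tendstoInMeasure_sub _ _ (hS k t ht) ?_ fun n =>
    (measurable_pi_lambda _ fun i => (hY n).1 (stepIndex n (t i))).aemeasurable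
  rw [tendstoInMeasure_iff_norm]
  intro ε hε
  rw [ENNReal.tendsto_nhds_zero]
  intro η hη
  -- A union bound over `k` times; `k + 1` also covers the empty tuple.
  have hη' : 0 < η / (k + 1) := ENNReal.div_pos hη.ne' (by finiteness)
  filter_upwards [eventually_embedding_sub_le hY hXT hemb hX htight hconv (half_pos hε) hη']
    with n hn
  calc _ ≤ P (⋃ i, {ω | ε / 2 < ‖XT n ω (t i) - Y n (stepIndex n (t i)) ω‖}) := by
        refine measure_mono fun ω hω => ?_
        by_contra hnot
        simp only [Set.mem_iUnion, Set.mem_ofPred_eq, not_exists, not_lt] at hnot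
        have h1 : ε ≤ ‖fun i => Y n (stepIndex n (t i)) ω - XT n ω (t i)‖ := by
          simpa using! hω
        have h2 : ‖fun i => Y n (stepIndex n (t i)) ω - XT n ω (t i)‖ ≤ ε / 2 :=
          (pi_norm_le_iff_of_nonneg (half_pos hε).le).2 fun i => by
            rw [norm_sub_rev]; exact hnot i
        linarith
    _ ≤ ∑ i : Fin k, η / (k + 1) :=
        (measure_iUnion_fintype_le _ _).trans (Finset.sum_le_sum fun i _ => hn (t i))
    _ = k * (η / (k + 1)) := by simp
    _ ≤ (k + 1) * (η / (k + 1)) := by gcongr; exact le_self_add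
    _ ≤ η := ENNReal.mul_div_le

end Chain

end SkorokhodEmbedding

end

theorem mainTheorem10 {Ω : Type*} [MeasurableSpace Ω] (P : Measure Ω) [IsProbabilityMeasure P]
    (d : ℕ) (T : SkorokhodEmbedding.SkorokhodTopology)
    (κ : ℕ → Kernel (SkorokhodEmbedding.E d) (SkorokhodEmbedding.E d))
    [∀ n, IsMarkovKernel (κ n)]
    (Y : ℕ → ℕ → Ω → SkorokhodEmbedding.E d)
    (hY : ∀ n, SkorokhodEmbedding.IsMarkovChain P (κ n) (Y n))
    (XT : ℕ → Ω → SkorokhodEmbedding.D d) (hXT : ∀ n, Measurable (XT n))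
    (hemb : ∀ n ω, SkorokhodEmbedding.IsEmbedding T n (fun k => Y n k ω) (XT n ω))
    (X : Ω → SkorokhodEmbedding.D d) (hX : Measurable X)
    (htight : SkorokhodEmbedding.TightnessCondition κ)
    (hconv : SkorokhodEmbedding.TendstoInDist T P XT X) :
    (∃ S : Set unitInterval, Dense S ∧ SkorokhodEmbedding.TendstoFDD P XT X S) ∧
    ∀ S : Set unitInterval, Dense S → SkorokhodEmbedding.TendstoFDD P XT X S →
      SkorokhodEmbedding.TendstoFDD P
        (fun n ω => SkorokhodEmbedding.stepEmbedding n (fun k => Y n k ω)) X S := by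
  have h := SkorokhodEmbedding.tendstoFDD_univ hY hXT hemb hX htight hconv
  exact ⟨⟨Set.univ, dense_univ, h⟩, fun S _ hS => hS.stepEmbedding hY hXT hemb hX htight hconv⟩
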